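/- Let $\mathbb T_M=\mathbb R^2/M\mathbb Z^2$ for a real $2\times 2$ matrix $M$ (a flat torus when $M$ is non-singular), and let $\mathbb T_\square=\mathbb T_I$. Let $G$ be a finite graph (loops and parallel edges allowed, each edge $e$ with a reference direction) with a geodesic drawing on $\mathbb T_\square$ that is homotopic to a cellular embedding of $G$. Let $\Delta$ be its $2\times E$ displacement matrix, with columns $\Delta_e$. Let $\omega$ be a (not necessarily positive) equilibrium stress: $\omega_e\neq 0$ for every edge $e$, and at every vertex the vectors $\omega_d\Delta_d$ of the darts $d$ leaving it sum to zero. Put $\Omega=\operatorname{diag}(\omega)$ and $M=\Delta\Omega\Delta^T$. Let the dual graph $G^*$ be naturally embedded on $\mathbb T_\square$ with respect to that embedding of $G$: each face of either embedding contains exactly one vertex of the other, and each dual edge $e^*$ meets the embedding of $G$ in a single point, where it crosses $e$ from its right to its left. A drawing of $G^*$ on $\mathbb T_N$ is *rotated dual* to $G$ if it is the image under the linear map $N:\mathbb T_\square\to\mathbb T_N$ of a drawing on $\mathbb T_\square$ homotopic to the natural embedding rotated clockwise by a quarter circle $\rho(x,y)=(y,-x)$. Then the universal cover of $G$ has a parallel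 reciprocal diagram, that is, an assignment $h$ of points of $\mathbb R^2$ to the vertices of the lift of $G^*$ to $\mathbb R^2$ such that each lift of $e^*$ has displacement $\omega_e\Delta_e$ (so it is parallel to $e$ and has signed length $\omega_e|e|$), and $h$ is doubly periodic with period matrix $M$: $h(\tilde f+z)=h(\tilde f)+M\rho(z)$ for every lifted dual vertex $\tilde f$ and every $z\in\mathbb Z^2$. If moreover $M$ is non-singular, the parallel force diagram of $G$ with respect to $\omega$ lies on the flat torus $\mathbb T_M$: there is a geodesic drawing $H$ of $G^*$ on $\mathbb T_M$, rotated dual to $G$, in which each dual edge $e^*$ has displacement $\omega_e\Delta_e$ and whose universal cover is the diagram $h$. -/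

import Mathlib

open Set Topology unitInterval

namespace TorusGraph

noncomputable section

/-! ### Flat tori -/

/-- The plane. Only its topology and its linear structure are used. -/
abbrev Plane : Type := Fin 2 → ℝ

/-- An integer vector, seen in the plane. -/
def intVec : (Fin 2 → ℤ) →+ Plane where
  toFun z := fun i => (z i : ℝ)
  map_zero' := by ext i; simp
  map_add' := by intro x y; ext i; simp

/-- The period lattice `M ℤ²`, spanned by the columns of `M`. -/
def lattice (M : Matrix (Fin 2) (Fin 2) ℝ) : AddSubgroup Plane :=
  ((Matrix.toLin' M).toAddMonoidHom.comp intVec).range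

/-- The quotient `ℝ² / M ℤ²` with its quotient topology. It is a flat torus when `M` is
non-singular. -/
abbrev FlatTorus (M : Matrix (Fin 2) (Fin 2) ℝ) : Type := Plane ⧸ lattice M

/-- The square flat torus `ℝ² / ℤ²`. -/
abbrev SquareTorus : Type := FlatTorus 1

/-- The projection of the plane onto `ℝ² / M ℤ²`. -/
def proj (M : Matrix (Fin 2) (Fin 2) ℝ) : C(Plane, FlatTorus M) where
  toFun x := (QuotientAddGroup.mk x : Plane ⧸ lattice M)
  continuous_toFun := continuous_quotient_mk'

/-- The map `ℝ² / A ℤ² → ℝ² / B ℤ²` induced by a linear map `L` that carries the first lattice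
into the second. -/
def inducedMap (A B L : Matrix (Fin 2) (Fin 2) ℝ)
    (h : lattice A ≤ (lattice B).comap (Matrix.toLin' L).toAddMonoidHom) :
    C(FlatTorus A, FlatTorus B) where
  toFun := QuotientAddGroup.map (lattice A) (lattice B) (Matrix.toLin' L).toAddMonoidHom h
  continuous_toFun := by
    refine continuous_quot_lift _ ?_
    exact (proj B).continuous.comp (LinearMap.continuous_of_finiteDimensional (Matrix.toLin' L))

/-- The map from the square torus to `ℝ² / M ℤ²` induced by `M`; a homeomorphism when `M` is
non-singular. -/
def affineImage (M : Matrix (Fin 2) (Fin 2) ℝ) : C(SquareTorus, FlatTorus M) :=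
  inducedMap 1 M M (by
    rintro _ ⟨z, rfl⟩
    exact ⟨z, by simp⟩)

/-- The clockwise rotation of the plane by a quarter circle, `(x, y) ↦ (y, -x)`. -/
def quarterTurn : Matrix (Fin 2) (Fin 2) ℝ := !![0, 1; -1, 0]

/-- The clockwise rotation of the square torus by a quarter circle. -/
def rotateSquare : C(SquareTorus, SquareTorus) :=
  inducedMap 1 1 quarterTurn (by
    rintro _ ⟨z, rfl⟩
    refine ⟨![z 1, - z 0], ?_⟩
    ext i
    fin_cases i <;> simp [quarterTurn, intVec, Matrix.mulVec, dotProduct, Fin.sum_univ_two])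

/-! ### Graphs and their drawings -/

/-- A graph with vertex set `V` and edge set `E`, loops and parallel edges allowed, every edge
with a reference direction. -/
structure Graph (V E : Type*) where
  /-- the tail of the reference dart of an edge -/
  tail : E → V
  /-- the head of the reference dart of an edge -/
  head : E → V

/-- A drawing of a graph on `X`: a continuous map to `X` from the graph as a topological space,
given by the images of the vertices and by a path for each edge. -/
@[ext]
structure Drawing {V E : Type*} (G : Graph V E) (X : Type*) [TopologicalSpace X] where
  /-- images of the vertices -/
  pos : V → X
  /-- images of the edges -/
  path : E → C(I, X)
  path_zero : ∀ e, path e 0 = pos (G.tail e)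
  path_one : ∀ e, path e 1 = pos (G.head e)

namespace Drawing

variable {V E : Type*} {G : Graph V E} {X Y : Type*} [TopologicalSpace X] [TopologicalSpace Y]

/-- The image of the graph. -/
def image (D : Drawing G X) : Set X :=
  Set.range D.pos ∪ ⋃ e, Set.range (D.path e)

/-- The image of a drawing under a continuous map. -/
def map (φ : C(X, Y)) (D : Drawing G X) : Drawing G Y where
  pos v := φ (D.pos v)
  path e := φ.comp (D.path e)
  path_zero e := by simp [D.path_zero]
  path_one e := by simp [D.path_one]

/-- Two drawings of the same graph are homotopic: a continuous family of drawings joins them. -/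
def Homotopic (D₀ D₁ : Drawing G X) : Prop :=
  ∃ Φ : I → Drawing G X,
    (∀ v, Continuous fun s => (Φ s).pos v) ∧
    (∀ e, Continuous fun st : I × I => (Φ st.1).path e st.2) ∧
    Φ 0 = D₀ ∧ Φ 1 = D₁

/-- A (cellular) embedding: distinct vertices go to distinct points, edges go to interior-disjoint
simple paths between their endpoints, and each face, that is, each component of the complement of
the image, is an open disk. -/
structure IsEmbedding (D : Drawing G X) : Prop where
  pos_injective : Function.Injective D.pos
  interior_injective : ∀ e₁ e₂ (t₁ t₂ : I), t₁ ∈ Ioo (0 : I) 1 →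
    D.path e₁ t₁ = D.path e₂ t₂ → e₁ = e₂ ∧ t₁ = t₂
  interior_ne_pos : ∀ e (t : I) v, t ∈ Ioo (0 : I) 1 → D.path e t ≠ D.pos v
  cellular : ∀ x, x ∉ D.image →
    Nonempty (connectedComponentIn D.imageᶜ x ≃ₜ Metric.ball (0 : ℂ) 1)

end Drawing

/-! ### Dual embeddings -/

/-- `v` is the total variation of the polar angle along the continuous path `p` in the plane
minus the origin. -/
def HasAngleVariation (p : I → Plane) (v : ℝ) : Prop :=
  ∃ θ : I → ℝ, Continuous θ ∧
    (∀ t, ∃ r : ℝ, 0 < r ∧ p t = ![r * Real.cos (θ t), r * Real.sin (θ t)]) ∧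
    θ 1 - θ 0 = v

/-- The algebraic crossing number of `p` by `q` is `n`, for two paths in the plane neither of
which contains an endpoint of the other. It is computed as the winding number around the origin
of the difference map `(s, t) ↦ q t - p s` along the boundary of the parameter square. A single
crossing of `p` by `q` counts `1` if `q` crosses from the right of `p` to its left, and `-1` if it
crosses from the left to the right. -/
def HasCrossingNumber (p q : C(I, Plane)) (n : ℤ) : Prop :=
  ∃ a b c d : ℝ,
    HasAngleVariation (fun t => q t - p 0) a ∧
    HasAngleVariation (fun t => q t - p 1) b ∧
    HasAngleVariation (fun s => p s - q 1) c ∧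
    HasAngleVariation (fun s => p s - q 0) d ∧
    a - b + c - d = 2 * Real.pi * n

/-- `q` is a lift to the plane of the path `p` on `ℝ² / M ℤ²`. -/
def IsLift {M : Matrix (Fin 2) (Fin 2) ℝ} (q : C(I, Plane)) (p : C(I, FlatTorus M)) : Prop :=
  ∀ t, proj M (q t) = p t

/-- `Ds` is a natural embedding of the dual graph of the graph embedded by `D` on the square
torus. The dual graph `Gs` has the same edges; the dual of the dart `e` leads from the face to the
right of `e` to the face to its left. Each face of either embedding contains exactly one vertex of
the other. The dual of `e` meets the embedded graph in a single point, where it crosses `e` from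
right to left. -/
structure IsNaturalDual {V E F : Type*} {G : Graph V E} {Gs : Graph F E}
    (D : Drawing G SquareTorus) (Ds : Drawing Gs SquareTorus) : Prop where
  embedding : D.IsEmbedding
  dual_embedding : Ds.IsEmbedding
  dual_pos_notMem : ∀ f, Ds.pos f ∉ D.image
  pos_notMem : ∀ v, D.pos v ∉ Ds.image
  face : ∀ x, x ∉ D.image → ∃! f, Ds.pos f ∈ connectedComponentIn D.imageᶜ x
  dual_face : ∀ x, x ∉ Ds.image → ∃! v, D.pos v ∈ connectedComponentIn Ds.imageᶜ x
  crosses_only : ∀ e e₁ (s t : I), D.path e₁ s = Ds.path e t → e₁ = e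
  crosses_once : ∀ e, ∃! st : I × I, D.path e st.1 = Ds.path e st.2
  crosses_right_to_left : ∀ e, ∃ p q : C(I, Plane), IsLift p (D.path e) ∧ IsLift q (Ds.path e) ∧
    (∃ s t, p s = q t) ∧ HasCrossingNumber p q 1

/-- For a natural embedding `Ds` of the dual of a torus graph on the square torus, a drawing `H` of
the dual graph on `ℝ² / M ℤ²` is rotated dual to that torus graph: on the square torus it becomes a
drawing that is homotopic to the clockwise rotation of `Ds` by a quarter circle. -/
def IsRotatedDual {E F : Type*} {Gs : Graph F E} (Ds : Drawing Gs SquareTorus)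
    {M : Matrix (Fin 2) (Fin 2) ℝ} (H : Drawing Gs (FlatTorus M)) : Prop :=
  ∃ K : Drawing Gs SquareTorus, K.map (affineImage M) = H ∧
    K.Homotopic (Ds.map rotateSquare)

/-! ### Geodesic drawings, stresses, force diagrams -/

/-- A geodesic drawing on `ℝ² / M ℤ²`: every edge is the projection of a straight line segment,
given by its displacement vector. -/
structure GeodesicDrawing {V E : Type*} (G : Graph V E) (M : Matrix (Fin 2) (Fin 2) ℝ) where
  /-- images of the vertices -/
  pos : V → FlatTorus M
  /-- displacement vectors of the edges, in their reference directions -/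
  disp : E → Plane
  pos_head : ∀ e, pos (G.head e) = pos (G.tail e) + proj M (disp e)

namespace GeodesicDrawing

variable {V E : Type*} {G : Graph V E} {M : Matrix (Fin 2) (Fin 2) ℝ}

/-- The underlying drawing; the edge `e` is traversed with constant velocity `disp e`. -/
def toDrawing (Γ : GeodesicDrawing G M) : Drawing G (FlatTorus M) where
  pos := Γ.pos
  path e :=
    { toFun := fun t => Γ.pos (G.tail e) + proj M ((t : ℝ) • Γ.disp e)
      continuous_toFun := by
        refine continuous_const.add ((proj M).continuous.comp ?_)
        fun_prop }
  path_zero e := by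
    have h : proj M 0 = 0 := rfl
    simp [h]
  path_one e := by simp [Γ.pos_head]

/-- The displacement matrix `Δ`, whose columns are the displacement vectors of the edges. -/
def dispMatrix (Γ : GeodesicDrawing G M) : Matrix (Fin 2) E ℝ :=
  Matrix.of fun i e => Γ.disp e i

/-- An equilibrium stress: non-zero edge weights, of any signs, such that at every vertex `v` the
weighted displacement vectors of all darts that leave `v` sum to zero. -/
def IsEquilibriumStress [Fintype E] [DecidableEq V] (Γ : GeodesicDrawing G M) (ω : E → ℝ) : Prop :=
  (∀ e, ω e ≠ 0) ∧
  ∀ v, (∑ e, if G.tail e = v then ω e • Γ.disp e else 0) +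
    (∑ e, if G.head e = v then ω e • (-Γ.disp e) else 0) = 0

/-- The covariance matrix `Δ Ω Δᵀ`. -/
def covariance [Fintype E] [DecidableEq E] (Γ : GeodesicDrawing G M) (ω : E → ℝ) :
    Matrix (Fin 2) (Fin 2) ℝ :=
  Γ.dispMatrix * Matrix.diagonal ω * Γ.dispMatrix.transpose

end GeodesicDrawing

/-- The parallel reciprocal diagram of the universal cover of the stressed geodesic graph `Γ`. The
vertices of the dual of the universal cover are the pairs of a dual vertex `f` and a point `x` of
the plane above its position in the natural embedding `Ds`; the diagram puts such a vertex at
`h f x`. The edge of the diagram that belongs to a lift of the dual edge of `e` has to be the vector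
`ω e • Γ.disp e`: parallel to `e`, of signed length `ω e` times the length of `e`. -/
def IsCoverReciprocal {V E F : Type*} {G : Graph V E} {Gs : Graph F E} (Γ : GeodesicDrawing G 1)
    (ω : E → ℝ) (Ds : Drawing Gs SquareTorus) (h : F → Plane → Plane) : Prop :=
  ∀ e (q : C(I, Plane)), IsLift q (Ds.path e) →
    h (Gs.head e) (q 1) - h (Gs.tail e) (q 0) = ω e • Γ.disp e

/-- The diagram `h` on the dual of the universal cover is doubly periodic with period lattice
matrix `M`: the clockwise rotation by a quarter circle turns a translation `z` of the universal
cover into a translation of the rotated dual, to which the period `M z` is assigned. -/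
def IsPeriodic {E F : Type*} {Gs : Graph F E} (M : Matrix (Fin 2) (Fin 2) ℝ)
    (Ds : Drawing Gs SquareTorus) (h : F → Plane → Plane) : Prop :=
  ∀ f x (z : Fin 2 → ℤ), proj 1 x = Ds.pos f →
    h f (x + intVec z) = h f x + M.mulVec (quarterTurn.mulVec (intVec z))

/-- `H` is a parallel force diagram, lying on `ℝ² / M ℤ²`, of the geodesic graph `Γ` on the square
torus with respect to the stress `ω`: a geodesic drawing of the dual graph, rotated dual to the
given graph, in which the dual of each edge `e` is the displacement vector `ω e • Γ.disp e`, and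
whose universal cover is the reciprocal diagram `h` of the universal cover of `Γ`. -/
structure IsParallelForceDiagram {V E F : Type*} {G : Graph V E} {Gs : Graph F E}
    (Γ : GeodesicDrawing G 1) (ω : E → ℝ) (Ds : Drawing Gs SquareTorus) (h : F → Plane → Plane)
    {M : Matrix (Fin 2) (Fin 2) ℝ} (H : GeodesicDrawing Gs M) : Prop where
  disp_eq : ∀ e, H.disp e = ω e • Γ.disp e
  rotated_dual : IsRotatedDual Ds H.toDrawing
  cover_reciprocal : IsCoverReciprocal Γ ω Ds h
  cover_periodic : IsPeriodic M Ds h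
  cover_pos : ∀ f x, proj 1 x = Ds.pos f → H.pos f = proj M (h f x)

end

end TorusGraph

namespace TorusGraph

noncomputable section

/-! ### Variation of the logarithm -/

/-! The diagram is one function on the plane, h(y) = ∑ c_e(y) ω_e Δ_e, whose coefficient c_e should
grow by 1 when y crosses a translate of the chosen lift `P e` from right to left. Equilibrium gives
∑ (u(tail e) - u(head e)) ω_e Δ_e = 0 for every function u on the vertices (`sum_coboundary`), so
the changes of c_e matter only up to such coboundaries.

To treat all translates of `P e` at once, take a continuous quasi-periodic function Θ
(`latticeTheta`) with simple zeros exactly at ℤ². Then c_e(y) is the variation of arg Θ(y - P_e(s))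
in s, divided by 2π, plus a term linear in y (`potential`).

Displacements: for a dual edge Q, the argument principle for Θ(Q(t) - P_e(s)) on the parameter
square says that c_e changes along Q by the crossing number plus a coboundary (`variation_eq`,
`potential_sub`). Only the edge crossed by Q survives, giving ω_e Δ_e.

Periods: under a translation z, the linear term and the quasi-period together change c_e by the
scalar product of the displacement of `P e` with ρ(z). By homotopy this displacement is Δ_e up to a
coboundary (`exists_coboundary`), so the total change is ΔΩΔᵀρ(z) (`potential_add_intVec`).

If M is non-singular, M⁻¹h and ρ respond to z by the same translation ρ(z). The straight-line
homotopy between them therefore descends to the square torus. -/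

/-- `ℓ` is the total variation along `p` of a continuous branch of the logarithm. -/
def HasLogVariation (p : I → ℂ) (ℓ : ℂ) : Prop :=
  ∃ L : I → ℂ, Continuous L ∧ (∀ t, Complex.exp (L t) = p t) ∧ L 1 - L 0 = ℓ

open Classical in
/-- The total variation of a continuous branch of the logarithm along `p`, if there is one. -/
def logVariation (p : I → ℂ) : ℂ :=
  if h : ∃ ℓ, HasLogVariation p ℓ then h.choose else 0

theorem exists_continuous_log {A : Type*} [TopologicalSpace A] [SimplyConnectedSpace A]
    [LocallyPathConnectedSpace A] {f : A → ℂ} (hf : Continuous f) (h0 : ∀ a, f a ≠ 0) :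
    ∃ L : A → ℂ, Continuous L ∧ ∀ a, Complex.exp (L a) = f a := by
  obtain ⟨a₀⟩ : Nonempty A := inferInstance
  obtain ⟨F, ⟨-, hF⟩, -⟩ := Complex.isCoveringMapOn_exp.existsUnique_continuousMap_lifts
    ⟨f, hf⟩ (Complex.exp_log (h0 a₀)) (fun a => h0 a)
  exact ⟨F, F.continuous, fun a => congrFun hF a⟩

instance : ContractibleSpace I := (convex_Icc (0 : ℝ) 1).contractibleSpace ⟨0, by simp⟩

instance : LocallyPathConnectedSpace I := (convex_Icc (0 : ℝ) 1).locallyPathConnectedSpace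

namespace HasLogVariation

variable {p q : I → ℂ} {a b : ℂ}

/-- Lifts through the covering exp that agree at 0 agree everywhere, so two branches differ by a
constant. -/
theorem unique (ha : HasLogVariation p a) (hb : HasLogVariation p b) : a = b := by
  obtain ⟨L, hL, hLp, rfl⟩ := ha
  obtain ⟨K, hK, hKp, rfl⟩ := hb
  have h := Complex.isCoveringMap_exp.eq_of_comp_eq (g₁ := L)
    (g₂ := fun t => K t + (L 0 - K 0)) hL (by fun_prop) (by
      funext t
      refine Subtype.ext ?_
      have h0 : p 0 ≠ 0 := hLp 0 ▸ Complex.exp_ne_zero _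
      change Complex.exp (L t) = Complex.exp (K t + (L 0 - K 0))
      rw [Complex.exp_add, Complex.exp_sub, hLp, hKp, hLp, hKp, div_self h0, mul_one]) 0 (by simp)
  rw [h]
  ring

theorem mul (ha : HasLogVariation p a) (hb : HasLogVariation q b) :
    HasLogVariation (fun t => p t * q t) (a + b) := by
  obtain ⟨L, hL, hLp, rfl⟩ := ha
  obtain ⟨K, hK, hKp, rfl⟩ := hb
  exact ⟨fun t => L t + K t, by fun_prop, fun t => by rw [Complex.exp_add, hLp, hKp], by ring⟩

theorem const_mul (ha : HasLogVariation p a) {c : ℂ} (hc : c ≠ 0) :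
    HasLogVariation (fun t => c * p t) a := by
  have h : HasLogVariation (fun _ => c) 0 :=
    ⟨fun _ => Complex.log c, by fun_prop, fun _ => Complex.exp_log hc, by simp⟩
  simpa using h.mul ha

theorem neg (ha : HasLogVariation p a) : HasLogVariation (fun t => -p t) a := by
  simpa using ha.const_mul (c := -1) (by simp)

theorem logVariation_eq (h : HasLogVariation p a) : logVariation p = a := by
  have hex : ∃ ℓ, HasLogVariation p ℓ := ⟨a, h⟩
  rw [logVariation, dif_pos hex]
  exact hex.choose_spec.unique h

end HasLogVariation

theorem hasLogVariation_exp {L : I → ℂ} (hL : Continuous L) :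
    HasLogVariation (fun t => Complex.exp (L t)) (L 1 - L 0) :=
  ⟨L, hL, fun _ => rfl, rfl⟩

theorem hasLogVariation_logVariation {p : I → ℂ} (hp : Continuous p) (h0 : ∀ t, p t ≠ 0) :
    HasLogVariation p (logVariation p) := by
  obtain ⟨L, hL, hLp⟩ := exists_continuous_log hp h0
  have h : HasLogVariation p (L 1 - L 0) := ⟨L, hL, hLp, rfl⟩
  rwa [h.logVariation_eq]

/-- The variation of the logarithm of a function without zeros around the unit square is zero. -/
theorem logVariation_square {f : I × I → ℂ} (hf : Continuous f) (h0 : ∀ x, f x ≠ 0)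
    {a b c d : ℂ} (ha : HasLogVariation (fun t => f (0, t)) a)
    (hb : HasLogVariation (fun t => f (1, t)) b) (hc : HasLogVariation (fun s => f (s, 1)) c)
    (hd : HasLogVariation (fun s => f (s, 0)) d) : a - b + c - d = 0 := by
  obtain ⟨L, hL, hLf⟩ := exists_continuous_log hf h0
  have ha' : HasLogVariation (fun t => f (0, t)) (L (0, 1) - L (0, 0)) :=
    ⟨fun t => L (0, t), by fun_prop, fun t => hLf _, rfl⟩
  have hb' : HasLogVariation (fun t => f (1, t)) (L (1, 1) - L (1, 0)) :=
    ⟨fun t => L (1, t), by fun_prop, fun t => hLf _, rfl⟩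
  have hc' : HasLogVariation (fun s => f (s, 1)) (L (1, 1) - L (0, 1)) :=
    ⟨fun t => L (t, 1), by fun_prop, fun t => hLf _, rfl⟩
  have hd' : HasLogVariation (fun s => f (s, 0)) (L (1, 0) - L (0, 0)) :=
    ⟨fun t => L (t, 0), by fun_prop, fun t => hLf _, rfl⟩
  rw [ha.unique ha', hb.unique hb', hc.unique hc', hd.unique hd']
  ring

/-- The plane as the complex line. -/
def toComplex (x : Plane) : ℂ := x 0 + x 1 * Complex.I

@[fun_prop]
theorem continuous_toComplex : Continuous toComplex := by
  unfold toComplex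
  fun_prop

theorem toComplex_eq_zero {x : Plane} (h : toComplex x = 0) : x = 0 := by
  have h0 := congrArg Complex.re h
  have h1 := congrArg Complex.im h
  simp [toComplex] at h0 h1
  ext i
  fin_cases i <;> simp [h0, h1]

theorem toComplex_neg (x : Plane) : toComplex (-x) = -toComplex x := by
  simp [toComplex]
  ring

/-- The real part depends only on the moduli at the endpoints and cancels around a parameter square;
the imaginary part carries the angle. -/
theorem HasAngleVariation.hasLogVariation {p : I → Plane} (hp : Continuous p) {v : ℝ}
    (h : HasAngleVariation p v) :
    HasLogVariation (fun t => toComplex (p t))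
      (Real.log ‖toComplex (p 1)‖ - Real.log ‖toComplex (p 0)‖ + v * Complex.I) := by
  obtain ⟨θ, hθ, hpθ, rfl⟩ := h
  have hpol : ∀ t, ∃ r : ℝ, 0 < r ∧ toComplex (p t) = r * Complex.exp (θ t * Complex.I) := by
    intro t
    obtain ⟨r, hr, h⟩ := hpθ t
    refine ⟨r, hr, ?_⟩
    rw [h, Complex.exp_mul_I]
    simp [toComplex]
    ring
  have hnorm : ∀ t, 0 < ‖toComplex (p t)‖ ∧
      toComplex (p t) = ‖toComplex (p t)‖ * Complex.exp (θ t * Complex.I) := by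
    intro t
    obtain ⟨r, hr, h⟩ := hpol t
    have : ‖toComplex (p t)‖ = r := by
      rw [h, norm_mul, Complex.norm_exp_ofReal_mul_I]
      simp [abs_of_pos hr]
    rw [this]
    exact ⟨hr, h⟩
  refine ⟨fun t => Real.log ‖toComplex (p t)‖ + θ t * Complex.I, ?_, ?_, ?_⟩
  · have : Continuous fun t => Real.log ‖toComplex (p t)‖ :=
      Continuous.log (by fun_prop) fun t => (hnorm t).1.ne'
    fun_prop
  · intro t
    rw [Complex.exp_add, ← Complex.ofReal_exp, Real.exp_log (hnorm t).1]
    exact (hnorm t).2.symm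
  · push_cast
    ring

/-! ### A quasi-periodic function that vanishes on the integer lattice -/

/-- The quasi-periodic function in the strip `|η| ≤ 1/2`. -/
def stripTheta (ξ η : ℝ) : ℂ :=
  Complex.exp (2 * Real.pi * (ξ + 1 / 2) * η * Complex.I) *
    (Real.sin (Real.pi * ξ) + Real.sin (Real.pi * η) * Real.cos (Real.pi * ξ) * Complex.I)

/-- A continuous quasi-periodic function on the plane with simple zeros at the integer points. -/
def latticeTheta (x : Plane) : ℂ := stripTheta (x 0) (Int.fract (x 1 + 1 / 2) - 1 / 2)

-- The only seam is η = ±1/2. There the exponential factor is ±i·exp(±πiξ) and the other factor is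
-- ±i·exp(∓πiξ), so the value is -1 on both sides. The shift in ξ + 1/2 is what makes the signs
-- match.
@[fun_prop]
theorem continuous_latticeTheta : Continuous latticeTheta := by
  have h := ContinuousOn.comp_fract (β := Plane) (s := fun x => x 1 + 1 / 2)
    (f := fun x u => stripTheta (x 0) (u - 1 / 2))
    (by unfold stripTheta; fun_prop) (by fun_prop) (by
      intro x
      unfold stripTheta
      have e1 : Real.pi * (0 - 1 / 2 : ℝ) = -(Real.pi / 2) := by ring
      have e2 : Real.pi * (1 - 1 / 2 : ℝ) = Real.pi / 2 := by ring
      rw [e1, e2, Real.sin_neg, Real.sin_pi_div_two]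
      have e3 : ∀ u : ℝ, 2 * (Real.pi : ℂ) * (x 0 + 1 / 2) * (u : ℝ) * Complex.I
        = ((2 * u * (Real.pi * x 0) + Real.pi * u : ℝ) : ℂ) * Complex.I := by
        intro u
        push_cast
        ring
      rw [e3, e3]
      have e4 : (2 * (0 - 1 / 2) * (Real.pi * x 0) + Real.pi * (0 - 1 / 2) : ℝ)
        = -(Real.pi * x 0) - Real.pi / 2 := by ring
      have e5 : (2 * (1 - 1 / 2) * (Real.pi * x 0) + Real.pi * (1 - 1 / 2) : ℝ)
        = Real.pi * x 0 + Real.pi / 2 := by ring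
      rw [e4, e5, Complex.exp_mul_I, Complex.exp_mul_I, ← Complex.ofReal_cos,
        ← Complex.ofReal_sin, ← Complex.ofReal_cos, ← Complex.ofReal_sin, Real.cos_sub_pi_div_two,
        Real.sin_sub_pi_div_two, Real.cos_add_pi_div_two, Real.sin_add_pi_div_two, Real.sin_neg,
        Real.cos_neg]
      push_cast
      ring)
  exact h

/-- The second coordinate enters only modulo 1. Translating the first gives the sign (-1)^(z 0) from
sine and cosine and a phase from the exponential. -/
theorem latticeTheta_add_intVec (x : Plane) (z : Fin 2 → ℤ) :
    latticeTheta (x + intVec z) =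
      Complex.exp (Real.pi * z 0 * (1 + 2 * x 1) * Complex.I) * latticeTheta x := by
  have h0 : (x + intVec z) 0 = x 0 + z 0 := rfl
  have h1 : (x + intVec z) 1 = x 1 + z 1 := rfl
  have h2 : Int.fract (x 1 + z 1 + 1 / 2) = Int.fract (x 1 + 1 / 2) := by
    rw [add_right_comm, Int.fract_add_intCast]
  unfold latticeTheta stripTheta
  rw [h0, h1, h2]
  have h3 : Int.fract (x 1 + 1 / 2) - 1 / 2 = x 1 - ⌊x 1 + 1 / 2⌋ := by
    rw [Int.fract]; ring
  rw [h3]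
  set m := ⌊x 1 + 1 / 2⌋
  rw [mul_add Real.pi, mul_comm Real.pi (z 0 : ℝ), Real.sin_add_int_mul_pi,
    Real.cos_add_int_mul_pi]
  -- Subtracting the integer `m` from `x 1` changes the exponent by a multiple of 2πi.
  have h4 : Complex.exp (Real.pi * z 0 * (1 + 2 * x 1) * Complex.I) =
      (-1) ^ (z 0) * Complex.exp (2 * Real.pi * z 0 * (x 1 - m) * Complex.I) := by
    have : (Real.pi * z 0 * (1 + 2 * x 1) * Complex.I : ℂ) = z 0 * (Real.pi * Complex.I) +
      2 * Real.pi * z 0 * (x 1 - m) * Complex.I + ((z 0 * m : ℤ) : ℂ) * (2 * Real.pi * Complex.I) := by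
      push_cast; ring
    rw [this, Complex.exp_add, Complex.exp_int_mul_two_pi_mul_I, Complex.exp_add,
      Complex.exp_int_mul, Complex.exp_pi_mul_I, mul_one]
  rw [h4]
  have h5 : (2 * Real.pi * (((x 0 + z 0 : ℝ) : ℂ) + 1 / 2) * ((x 1 - m : ℝ) : ℂ) * Complex.I : ℂ) =
      2 * Real.pi * z 0 * (x 1 - m) * Complex.I +
        2 * Real.pi * (x 0 + 1 / 2) * ((x 1 - m : ℝ) : ℂ) * Complex.I := by
    push_cast; ring
  rw [h5, Complex.exp_add]
  push_cast
  ring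

theorem exists_intVec_of_latticeTheta_eq_zero {x : Plane} (h : latticeTheta x = 0) :
    ∃ z, x = intVec z := by
  unfold latticeTheta stripTheta at h
  have h' := (mul_eq_zero.mp h).resolve_left (Complex.exp_ne_zero _)
  have hr := congrArg Complex.re h'
  have hi := congrArg Complex.im h'
  simp only [Complex.add_re, Complex.add_im, Complex.mul_re, Complex.mul_im, Complex.ofReal_re,
    Complex.ofReal_im, Complex.I_re, Complex.I_im, Complex.zero_re, Complex.zero_im, mul_zero,
    mul_one, zero_mul, sub_zero, add_zero, zero_add] at hr hi
  have hc : Real.cos (Real.pi * x 0) ≠ 0 := by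
    intro hc
    have := Real.sin_sq_add_cos_sq (Real.pi * x 0)
    rw [hr, hc] at this
    norm_num at this
  have hs := (mul_eq_zero.mp hi).resolve_right hc
  obtain ⟨m, hm⟩ := Real.sin_eq_zero_iff.mp hr
  obtain ⟨n, hn⟩ := Real.sin_eq_zero_iff.mp hs
  have hm' : x 0 = m := mul_left_cancel₀ Real.pi_ne_zero (by linarith)
  have hn' : Int.fract (x 1 + 1 / 2) - 1 / 2 = n := mul_left_cancel₀ Real.pi_ne_zero (by linarith)
  rw [Int.fract] at hn'
  refine ⟨![m, n + ⌊x 1 + 1 / 2⌋], ?_⟩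
  ext i
  fin_cases i
  · simpa [intVec] using hm'
  · simp [intVec]
    linarith

open Classical in
/-- The quotient of `latticeTheta` by its zero at the origin. -/
def latticeThetaQuot (x : Plane) : ℂ :=
  if x = 0 then (Real.pi : ℂ) else latticeTheta x / toComplex x

theorem latticeTheta_zero : latticeTheta 0 = 0 := by
  have : Int.fract (1 / 2 : ℝ) = 1 / 2 := by rw [Int.fract_eq_self]; norm_num
  simp only [latticeTheta, stripTheta, Pi.zero_apply, zero_add, this]
  simp

theorem latticeTheta_eq_mul (x : Plane) :
    latticeTheta x = toComplex x * latticeThetaQuot x := by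
  unfold latticeThetaQuot
  split_ifs with h
  · subst h
    simp [latticeTheta_zero, toComplex]
  · rw [mul_div_cancel₀]
    exact fun h' => h (toComplex_eq_zero h')

theorem latticeThetaQuot_ne_zero {x : Plane} (h : ∀ z, x = intVec z → x = 0) :
    latticeThetaQuot x ≠ 0 := by
  unfold latticeThetaQuot
  split_ifs with h0
  · exact_mod_cast Real.pi_ne_zero
  · refine div_ne_zero (fun h' => ?_) fun h' => h0 (toComplex_eq_zero h')
    obtain ⟨z, hz⟩ := exists_intVec_of_latticeTheta_eq_zero h'
    exact h0 (h z hz)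

theorem norm_div_toComplex_le (x : Plane) : ‖(x 0 : ℂ) / toComplex x‖ ≤ 1 := by
  rw [norm_div]
  refine div_le_one_of_le₀ ?_ (norm_nonneg _)
  have := Complex.abs_re_le_norm (toComplex x)
  simpa [toComplex] using this

-- Near 0 write w = `toComplex x`; the quotient is E·(b + r·x₀/w) with r → 0. The factor x₀/w has no
-- limit at 0 but is bounded by 1, so the second term vanishes in the limit.
@[fun_prop]
theorem continuous_latticeThetaQuot : Continuous latticeThetaQuot := by
  rw [continuous_iff_continuousAt]
  intro x
  by_cases hx : x = 0
  · subst hx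
    let b : Plane → ℂ := fun x =>
      (Real.sinc (Real.pi * x 1) * Real.cos (Real.pi * x 0) : ℝ)
    let r : Plane → ℂ := fun x => (Real.sinc (Real.pi * x 0) : ℝ) - b x
    let E : Plane → ℂ := fun x =>
      Complex.exp (2 * Real.pi * (x 0 + 1 / 2) * x 1 * Complex.I) * Real.pi
    have hsinc := Real.continuous_sinc
    have hb : Continuous b := by fun_prop
    have hr : Continuous r := by fun_prop
    have hE : Continuous E := by fun_prop
    have hb0 : b 0 = 1 := by simp [b]
    have hr0 : r 0 = 0 := by simp [r, hb0]
    have hE0 : E 0 = Real.pi := by simp [E]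
    have heq : latticeThetaQuot =ᶠ[𝓝 0] fun x => E x * (b x + r x * ((x 0 : ℂ) / toComplex x)) := by
      have hlt : ∀ᶠ x : Plane in 𝓝 0, x 1 ∈ Set.Ioo (-(1 / 2) : ℝ) (1 / 2) :=
        (continuous_apply 1).continuousAt.eventually
          (isOpen_Ioo.mem_nhds (by simp))
      filter_upwards [hlt] with x hx
      unfold latticeThetaQuot
      split_ifs with h0
      · subst h0
        simp [hb0, hE0]
      · have hc : toComplex x ≠ 0 := fun h' => h0 (toComplex_eq_zero h')
        have hf : Int.fract (x 1 + 1 / 2) - 1 / 2 = x 1 := by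
          rw [Int.fract_eq_self.mpr ⟨by linarith [hx.1], by linarith [hx.2]⟩]
          ring
        have hs : ∀ u : ℝ, (Real.sin u : ℂ) = u * Real.sinc u := by
          intro u
          by_cases hu : u = 0
          · simp [hu]
          · rw [Real.sinc_of_ne_zero hu]
            have : (u : ℂ) ≠ 0 := by exact_mod_cast hu
            push_cast
            field_simp
        rw [div_eq_iff hc, latticeTheta, hf, stripTheta, hs, hs]
        have : r x * ((x 0 : ℂ) / toComplex x) * toComplex x = r x * x 0 := by
          field_simp
        rw [mul_assoc (E x), add_mul, this]
        simp only [E, r, b, toComplex]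
        push_cast
        ring
    have hval : latticeThetaQuot 0 = Real.pi := by simp [latticeThetaQuot]
    rw [ContinuousAt, hval]
    refine Filter.Tendsto.congr' heq.symm ?_
    have h1 : Filter.Tendsto (fun x : Plane => r x * ((x 0 : ℂ) / toComplex x)) (𝓝 0) (𝓝 0) :=
      Filter.Tendsto.zero_mul_isBoundedUnder_le (hr0 ▸ hr.tendsto 0)
        (Filter.isBoundedUnder_of ⟨1, norm_div_toComplex_le⟩)
    have h2 := (hE.tendsto 0).mul ((hb.tendsto 0).add h1)
    simpa [hE0, hb0] using h2
  · have hc : toComplex x ≠ 0 := fun h' => hx (toComplex_eq_zero h')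
    have heq : latticeThetaQuot =ᶠ[𝓝 x] fun x => latticeTheta x / toComplex x := by
      filter_upwards [isOpen_ne.mem_nhds hx] with y hy
      rw [latticeThetaQuot, if_neg hy]
    refine ContinuousAt.congr ?_ heq.symm
    exact continuous_latticeTheta.continuousAt.div continuous_toComplex.continuousAt hc

/-- The quasi-period factor has an explicit logarithm, affine in the second coordinate of the path.
-/
theorem HasLogVariation.latticeTheta_add_intVec {p : I → Plane} (hp : Continuous p) {a : ℂ}
    (h : HasLogVariation (fun t => latticeTheta (p t)) a) (z : Fin 2 → ℤ) :
    HasLogVariation (fun t => latticeTheta (p t + intVec z))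
      (a + ((2 * Real.pi * (z 0 * (p 1 1 - p 0 1)) : ℝ) : ℂ) * Complex.I) := by
  have hL : Continuous fun t => (Real.pi * z 0 * (1 + 2 * p t 1) * Complex.I : ℂ) := by fun_prop
  have h2 := (hasLogVariation_exp hL).mul h
  simp_rw [TorusGraph.latticeTheta_add_intVec]
  convert h2 using 1
  push_cast
  ring

/-- The crossing number of two paths that only meet one another, but no translates of one
another, computed with `latticeTheta`. -/
theorem HasCrossingNumber.latticeTheta_variation {p q : C(I, Plane)} {n : ℤ}
    (h : HasCrossingNumber p q n)
    (hpq : ∀ s t z, q t - p s = intVec z → q t - p s = 0) {a b c d : ℂ}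
    (ha : HasLogVariation (fun t => latticeTheta (q t - p 0)) a)
    (hb : HasLogVariation (fun t => latticeTheta (q t - p 1)) b)
    (hc : HasLogVariation (fun s => latticeTheta (q 1 - p s)) c)
    (hd : HasLogVariation (fun s => latticeTheta (q 0 - p s)) d) :
    a - b + c - d = ((2 * Real.pi * n : ℝ) : ℂ) * Complex.I := by
  obtain ⟨a', b', c', d', ha', hb', hc', hd', hn⟩ := h
  have hA := HasAngleVariation.hasLogVariation (by fun_prop) ha'
  have hB := HasAngleVariation.hasLogVariation (by fun_prop) hb'
  -- The definition of the crossing number uses p - q on these two sides; a change of sign does not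
  -- affect the variation.
  have hC := (HasAngleVariation.hasLogVariation (by fun_prop) hc').neg
  have hD := (HasAngleVariation.hasLogVariation (by fun_prop) hd').neg
  simp only [← toComplex_neg, neg_sub] at hC hD
  -- Θ is `toComplex` times a quotient which, by `hpq`, has no zeros on the square. The quotient
  -- contributes nothing around the boundary, and `toComplex` contributes the crossing number.
  have hQ : Continuous fun x : I × I => latticeThetaQuot (q x.2 - p x.1) := by fun_prop
  have hQ0 : ∀ x : I × I, latticeThetaQuot (q x.2 - p x.1) ≠ 0 := fun x =>
    latticeThetaQuot_ne_zero (hpq x.1 x.2)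
  have side : ∀ γ : I → I × I, Continuous γ →
      HasLogVariation (fun t => latticeThetaQuot (q (γ t).2 - p (γ t).1)) _ := fun γ hγ =>
    hasLogVariation_logVariation (hQ.comp hγ) fun t => hQ0 (γ t)
  have gA := side (fun t => (0, t)) (by fun_prop)
  have gB := side (fun t => (1, t)) (by fun_prop)
  have gC := side (fun t => (t, 1)) (by fun_prop)
  have gD := side (fun t => (t, 0)) (by fun_prop)
  have hsq := logVariation_square hQ hQ0 gA gB gC gD
  simp only [latticeTheta_eq_mul] at ha hb hc hd
  rw [ha.unique (hA.mul gA), hb.unique (hB.mul gB), hc.unique (hC.mul gC), hd.unique (hD.mul gD)]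
  have hn' : (a' - b' + c' - d' : ℂ) = 2 * Real.pi * n := by exact_mod_cast hn
  have e : ∀ x y : Plane, ‖toComplex (x - y)‖ = ‖toComplex (y - x)‖ := fun x y => by
    rw [← neg_sub, toComplex_neg, norm_neg]
  rw [e (p 1) (q 1), e (p 0) (q 1), e (p 1) (q 0), e (p 0) (q 0)]
  push_cast
  linear_combination hsq + Complex.I * hn'

/-! ### The square torus and its universal cover -/

theorem proj_eq_proj_iff {M : Matrix (Fin 2) (Fin 2) ℝ} {x y : Plane} :
    proj M x = proj M y ↔ ∃ z, y = x + M.mulVec (intVec z) := by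
  change (QuotientAddGroup.mk x : Plane ⧸ lattice M) = QuotientAddGroup.mk y ↔ _
  rw [QuotientAddGroup.eq]
  constructor
  · rintro ⟨z, hz⟩
    refine ⟨z, ?_⟩
    have hz' : M.mulVec (intVec z) = -x + y := hz
    rw [hz']
    abel
  · rintro ⟨z, rfl⟩
    refine ⟨z, ?_⟩
    change M.mulVec (intVec z) = _
    abel

theorem proj_one_eq_proj_iff {x y : Plane} : proj 1 x = proj 1 y ↔ ∃ z, y = x + intVec z := by
  simp [proj_eq_proj_iff]

theorem proj_add (M : Matrix (Fin 2) (Fin 2) ℝ) (x y : Plane) :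
    proj M (x + y) = proj M x + proj M y := rfl

theorem proj_surjective (M : Matrix (Fin 2) (Fin 2) ℝ) : Function.Surjective (proj M) :=
  QuotientAddGroup.mk_surjective

theorem quarterTurn_mulVec (x : Plane) : quarterTurn.mulVec x = ![x 1, -x 0] := by
  ext i
  fin_cases i <;> simp [quarterTurn, Matrix.mulVec, dotProduct, Fin.sum_univ_two]

theorem exists_intVec_eq_quarterTurn (z : Fin 2 → ℤ) :
    ∃ w, quarterTurn.mulVec (intVec z) = intVec w := by
  refine ⟨![z 1, -z 0], ?_⟩
  rw [quarterTurn_mulVec]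
  ext i
  fin_cases i <;> simp [intVec]

/-- Two lifts of a path to the universal cover differ by a lattice translation. -/
theorem IsLift.exists_eq_add {p : C(I, SquareTorus)} {q q' : C(I, Plane)} (hq : IsLift q p)
    (hq' : IsLift q' p) : ∃ z, ∀ t, q' t = q t + intVec z := by
  have h : ∀ t, ∃ z, q' t = q t + intVec z := fun t =>
    proj_one_eq_proj_iff.mp ((hq t).trans (hq' t).symm)
  choose z hz using h
  refine ⟨z 0, fun t => ?_⟩
  have hzt : z t = z 0 := by
    ext i
    have hc : Continuous fun t => ((z t i : ℤ) : ℝ) := by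
      have : (fun t => ((z t i : ℤ) : ℝ)) = fun t => q' t i - q t i := by
        ext t
        simp [hz t, intVec]
      rw [this]
      fun_prop
    have hc' : Continuous fun t => z t i :=
      Int.isClosedEmbedding_coe_real.isEmbedding.continuous_iff.mpr hc
    exact PreconnectedSpace.constant inferInstance hc'
  rw [hz t, hzt]

/-- The `j`-th coordinate character of the square torus. -/
def torusChar (j : Fin 2) : C(SquareTorus, ℂ) where
  toFun := Quotient.lift (fun x : Plane => Complex.exp (2 * Real.pi * x j * Complex.I)) (by
    intro x y hxy
    obtain ⟨z, rfl⟩ := proj_one_eq_proj_iff.mp (Quotient.sound hxy : proj 1 x = proj 1 y)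
    have : (2 * Real.pi * ((x + intVec z) j : ℝ) * Complex.I : ℂ) =
        2 * Real.pi * x j * Complex.I + z j * (2 * Real.pi * Complex.I) := by
      simp [intVec]
      ring
    change _ = Complex.exp (2 * Real.pi * ((x + intVec z) j : ℝ) * Complex.I)
    rw [this, Complex.exp_add, Complex.exp_int_mul_two_pi_mul_I, mul_one])
  continuous_toFun := continuous_quot_lift _ (by fun_prop)

theorem torusChar_ne_zero (j : Fin 2) (y : SquareTorus) : torusChar j y ≠ 0 := by
  obtain ⟨x, rfl⟩ := proj_surjective 1 y
  exact Complex.exp_ne_zero _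

theorem hasLogVariation_torusChar (j : Fin 2) (q : C(I, Plane)) :
    HasLogVariation (fun t => torusChar j (proj 1 (q t)))
      ((2 * Real.pi * (q 1 j - q 0 j) : ℝ) * Complex.I) := by
  have h := hasLogVariation_exp (L := fun t => (2 * Real.pi * q t j * Complex.I : ℂ)) (by fun_prop)
  have e : (((2 * Real.pi * (q 1 j - q 0 j) : ℝ) : ℂ) * Complex.I) =
      2 * Real.pi * q 1 j * Complex.I - 2 * Real.pi * q 0 j * Complex.I := by
    push_cast
    ring
  rw [e]
  exact h

variable {V E F : Type*} {G : Graph V E} {Gs : Graph F E}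

/-- Homotopic drawings have the same displacement vectors up to a coboundary. -/
theorem GeodesicDrawing.exists_coboundary {Γ : GeodesicDrawing G 1} {D : Drawing G SquareTorus}
    (h : Γ.toDrawing.Homotopic D) {P : E → C(I, Plane)} (hP : ∀ e, IsLift (P e) (D.path e))
    (j : Fin 2) :
    ∃ b : V → ℝ, ∀ e, P e 1 j - P e 0 j - Γ.disp e j = b (G.head e) - b (G.tail e) := by
  obtain ⟨Φ, hpos, hpath, h0, h1⟩ := h
  -- The witness is the displacement of each vertex in coordinate `j` during the homotopy. Each edge
  -- sweeps out a square on which the character has no zeros.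
  refine ⟨fun v => (logVariation fun s => torusChar j ((Φ s).pos v)).im / (2 * Real.pi),
    fun e => ?_⟩
  have hv : ∀ v, HasLogVariation (fun s => torusChar j ((Φ s).pos v)) _ := fun v =>
    hasLogVariation_logVariation ((torusChar j).continuous.comp (hpos v))
      fun _ => torusChar_ne_zero _ _
  obtain ⟨x, hx⟩ := proj_surjective 1 (Γ.pos (G.tail e))
  have ha : HasLogVariation (fun t => torusChar j ((Φ 0).path e t))
      ((2 * Real.pi * Γ.disp e j : ℝ) * Complex.I) := by
    have := hasLogVariation_torusChar j ⟨fun t : I => x + (t : ℝ) • Γ.disp e, by fun_prop⟩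
    rw [h0]
    convert this using 1
    · ext t
      simp [GeodesicDrawing.toDrawing, proj_add, hx]
    · simp
  have hb : HasLogVariation (fun t => torusChar j ((Φ 1).path e t))
      ((2 * Real.pi * (P e 1 j - P e 0 j) : ℝ) * Complex.I) := by
    have := hasLogVariation_torusChar j (P e)
    simp only [hP e _] at this
    rwa [h1]
  have hc : HasLogVariation (fun s => torusChar j ((Φ s).path e 1))
      (logVariation fun s => torusChar j ((Φ s).pos (G.head e))) := by
    simpa only [(Φ _).path_one] using hv (G.head e)
  have hd : HasLogVariation (fun s => torusChar j ((Φ s).path e 0))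
      (logVariation fun s => torusChar j ((Φ s).pos (G.tail e))) := by
    simpa only [(Φ _).path_zero] using hv (G.tail e)
  have hsq := logVariation_square (f := fun x : I × I => torusChar j ((Φ x.1).path e x.2))
    ((torusChar j).continuous.comp (hpath e)) (fun _ => torusChar_ne_zero _ _) ha hb hc hd
  have him := congrArg Complex.im hsq
  simp only [Complex.add_im, Complex.sub_im, Complex.im_ofReal_mul,
    Complex.I_im, Complex.zero_im] at him
  have := Real.pi_pos
  field_simp
  linarith

/-! ### Equilibrium stresses and the reciprocal potential -/

namespace GeodesicDrawing

variable [Fintype E] {Γ : GeodesicDrawing G 1} {ω : E → ℝ}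

/-- Summation by parts: weight the equilibrium condition at each vertex by `u` and collect the two
ends of each edge. -/
theorem IsEquilibriumStress.sum_coboundary [Fintype V] [DecidableEq V]
    (hω : Γ.IsEquilibriumStress ω) (u : V → ℝ) :
    ∑ e, (u (G.tail e) - u (G.head e)) • ω e • Γ.disp e = 0 := by
  have h : ∑ v, u v • ((∑ e, if G.tail e = v then ω e • Γ.disp e else 0) +
      ∑ e, if G.head e = v then ω e • (-Γ.disp e) else 0) = 0 :=
    Finset.sum_eq_zero fun v _ => by rw [hω.2 v, smul_zero]
  simp only [smul_add, Finset.smul_sum, Finset.sum_add_distrib] at h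
  rw [Finset.sum_comm, Finset.sum_comm (s := (Finset.univ : Finset V))] at h
  simp only [smul_ite, smul_zero, Finset.sum_ite_eq, Finset.mem_univ, if_true] at h
  rw [← Finset.sum_add_distrib] at h
  rw [← h]
  refine Finset.sum_congr rfl fun e _ => ?_
  module

theorem covariance_mulVec [DecidableEq E] (Γ : GeodesicDrawing G 1) (ω : E → ℝ) (v : Plane) :
    (Γ.covariance ω).mulVec v =
      ∑ e, (Γ.disp e 0 * v 0 + Γ.disp e 1 * v 1) • ω e • Γ.disp e := by
  ext i
  simp only [covariance, Matrix.mulVec, dotProduct, Fin.sum_univ_two]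
  rw [Matrix.mul_apply, Matrix.mul_apply]
  simp only [Matrix.mul_diagonal, dispMatrix, Matrix.of_apply, Matrix.transpose_apply, Finset.sum_apply,
    Pi.smul_apply, smul_eq_mul, Finset.sum_mul, ← Finset.sum_add_distrib]
  exact Finset.sum_congr rfl fun e _ => by ring

/-- The reciprocal potential of a stressed geodesic drawing, with respect to lifts `P` of the
edges of a homotopic embedding. -/
def potential (Γ : GeodesicDrawing G 1) (ω : E → ℝ) (P : E → C(I, Plane)) (y : Plane) : Plane :=
  ∑ e, ((P e 1 0 - P e 0 0) * y 1 +
    (logVariation fun s => latticeTheta (y - P e s)).im / (2 * Real.pi)) • ω e • Γ.disp e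

end GeodesicDrawing

theorem latticeTheta_sub_ne_zero {x y : Plane} (h : proj 1 x ≠ proj 1 y) :
    latticeTheta (x - y) ≠ 0 := by
  intro h0
  obtain ⟨z, hz⟩ := exists_intVec_of_latticeTheta_eq_zero h0
  exact h (proj_one_eq_proj_iff.mpr ⟨z, by rw [← hz]; abel⟩).symm

theorem Drawing.path_mem_image (D : Drawing G SquareTorus) (e : E) (s : I) :
    D.path e s ∈ D.image :=
  Or.inr (mem_iUnion.mpr ⟨e, s, rfl⟩)

theorem IsLift.hasLogVariation_sub {D : Drawing G SquareTorus} {e : E} {p : C(I, Plane)}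
    (hp : IsLift p (D.path e)) {y : Plane} (hy : proj 1 y ∉ D.image) :
    HasLogVariation (fun s => latticeTheta (y - p s))
      (logVariation fun s => latticeTheta (y - p s)) := by
  refine hasLogVariation_logVariation (by fun_prop) fun s => latticeTheta_sub_ne_zero fun h => ?_
  rw [h, hp] at hy
  exact hy (D.path_mem_image e s)

theorem IsLift.hasLogVariation_sub' {Ds : Drawing Gs SquareTorus} {e : E} {q : C(I, Plane)}
    (hq : IsLift q (Ds.path e)) {x : Plane} (hx : proj 1 x ∉ Ds.image) :
    HasLogVariation (fun t => latticeTheta (q t - x))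
      (logVariation fun t => latticeTheta (q t - x)) := by
  refine hasLogVariation_logVariation (by fun_prop) fun s => latticeTheta_sub_ne_zero fun h => ?_
  rw [← h, hq] at hx
  exact hx (Ds.path_mem_image e s)

theorem GeodesicDrawing.potential_add_intVec [Fintype V] [DecidableEq V] [Fintype E]
    [DecidableEq E] {Γ : GeodesicDrawing G 1} {ω : E → ℝ} (hω : Γ.IsEquilibriumStress ω)
    {D : Drawing G SquareTorus} (hΓ : Γ.toDrawing.Homotopic D) {P : E → C(I, Plane)}
    (hP : ∀ e, IsLift (P e) (D.path e)) {y : Plane} (hy : proj 1 y ∉ D.image) (z : Fin 2 → ℤ) :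
    Γ.potential ω P (y + intVec z) =
      Γ.potential ω P y + (Γ.covariance ω).mulVec (quarterTurn.mulVec (intVec z)) := by
  obtain ⟨b₀, hb₀⟩ := exists_coboundary hΓ hP 0
  obtain ⟨b₁, hb₁⟩ := exists_coboundary hΓ hP 1
  have hvar : ∀ e, (logVariation fun s => latticeTheta (y + intVec z - P e s)).im =
      (logVariation fun s => latticeTheta (y - P e s)).im -
        2 * Real.pi * (z 0 * (P e 1 1 - P e 0 1)) := by
    intro e
    have h := ((hP e).hasLogVariation_sub hy).latticeTheta_add_intVec (by fun_prop) z
    simp only [sub_add_eq_add_sub] at h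
    rw [h.logVariation_eq]
    simp only [Complex.add_im, Complex.im_ofReal_mul, Complex.I_im, Pi.sub_apply]
    ring
  -- The displacement of `P e` differs from Δ_e by the coboundary of (b₀, b₁); pairing with ρ(z) =
  -- (z 1, -z 0) gives this vertex function.
  have hsum := hω.sum_coboundary fun v => b₀ v * z 1 - b₁ v * z 0
  rw [covariance_mulVec, potential, potential, ← Finset.sum_add_distrib, ← sub_eq_zero,
    ← neg_eq_zero, ← hsum, ← Finset.sum_sub_distrib, ← Finset.sum_neg_distrib]
  refine Finset.sum_congr rfl fun e _ => ?_
  rw [← add_smul, ← sub_smul, ← neg_smul]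
  congr 1
  have h1 : (y + intVec z) 1 = y 1 + z 1 := rfl
  rw [hvar, quarterTurn_mulVec, h1]
  have hz : ∀ i, intVec z i = z i := fun _ => rfl
  simp only [Matrix.cons_val_zero, Matrix.cons_val_one, hz]
  have := Real.pi_pos
  field_simp
  linear_combination (-(2 * Real.pi * z 1 : ℝ)) * hb₀ e + (2 * Real.pi * z 0 : ℝ) * hb₁ e

theorem proj_ne_of_lifts {p q : Plane} {x y : SquareTorus} (hp : proj 1 p = x)
    (hq : proj 1 q = y) (h : x ≠ y) (z : Fin 2 → ℤ) : q - p ≠ intVec z := by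
  intro hz
  exact h (by rw [← hp, ← hq, proj_one_eq_proj_iff]; exact ⟨z, by rw [← hz]; abel⟩)

/-! ### Change of the potential along dual edges. -/

section Lifts

variable {D : Drawing G SquareTorus} {Ds : Drawing Gs SquareTorus} {P Q : E → C(I, Plane)}

/-- The dual of `e` crosses only `e`, and crosses it once, from right to left. -/
theorem IsNaturalDual.variation_eq [DecidableEq E] (hD : IsNaturalDual D Ds)
    (hP : ∀ e, IsLift (P e) (D.path e)) (hQ : ∀ e, IsLift (Q e) (Ds.path e))
    (hmeet : ∀ e, ∃ s t, P e s = Q e t) (hcross : ∀ e, HasCrossingNumber (P e) (Q e) 1)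
    (e e₁ : E) :
    (logVariation fun t => latticeTheta (Q e t - P e₁ 0)) -
      (logVariation fun t => latticeTheta (Q e t - P e₁ 1)) +
      (logVariation fun s => latticeTheta (Q e 1 - P e₁ s)) -
      (logVariation fun s => latticeTheta (Q e 0 - P e₁ s)) =
    if e₁ = e then ((2 * Real.pi : ℝ) : ℂ) * Complex.I else 0 := by
  have hP0 : proj 1 (P e₁ 0) ∉ Ds.image := by
    rw [hP, D.path_zero]
    exact hD.pos_notMem _
  have hP1 : proj 1 (P e₁ 1) ∉ Ds.image := by
    rw [hP, D.path_one]
    exact hD.pos_notMem _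
  have hQ0 : proj 1 (Q e 0) ∉ D.image := by
    rw [hQ, Ds.path_zero]
    exact hD.dual_pos_notMem _
  have hQ1 : proj 1 (Q e 1) ∉ D.image := by
    rw [hQ, Ds.path_one]
    exact hD.dual_pos_notMem _
  have ha := (hQ e).hasLogVariation_sub' hP0
  have hb := (hQ e).hasLogVariation_sub' hP1
  have hc := (hP e₁).hasLogVariation_sub hQ1
  have hd := (hP e₁).hasLogVariation_sub hQ0
  split_ifs with h
  · subst h
    have := (hcross e₁).latticeTheta_variation (fun s t z hz => ?_) ha hb hc hd
    · simpa using this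
    -- An integral difference of the lifts is a crossing on the torus. There is only one, and the
    -- chosen lifts themselves meet at its parameters, so no other translates meet.
    · obtain ⟨s₀, t₀, h₀⟩ := hmeet e₁
      have hst : D.path e₁ s = Ds.path e₁ t := by
        by_contra hne
        exact proj_ne_of_lifts (hP e₁ s) (hQ e₁ t) hne z hz
      have hst₀ : D.path e₁ s₀ = Ds.path e₁ t₀ := by
        rw [← hP e₁, ← hQ e₁, h₀]
      have heq := (hD.crosses_once e₁).unique (y₁ := (s, t)) (y₂ := (s₀, t₀)) hst hst₀
      obtain ⟨rfl, rfl⟩ := Prod.mk.inj heq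
      rw [h₀, sub_self]
  · refine logVariation_square (f := fun x : I × I => latticeTheta (Q e x.2 - P e₁ x.1))
      (by fun_prop) (fun x => latticeTheta_sub_ne_zero fun hx => h ?_) ha hb hc hd
    rw [hQ e, hP e₁] at hx
    exact hD.crosses_only e e₁ x.1 x.2 hx.symm

/-- The variation along a dual edge depends, after a linear correction, only on the vertex of the
torus graph. -/
theorem IsLift.variation_add_intVec {e : E} {q : C(I, Plane)} (hq : IsLift q (Ds.path e))
    {x : Plane} (hx : proj 1 x ∉ Ds.image) (z : Fin 2 → ℤ) :
    (logVariation fun t => latticeTheta (q t - (x + intVec z))).im =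
      (logVariation fun t => latticeTheta (q t - x)).im
        - 2 * Real.pi * (z 0 * (q 1 1 - q 0 1)) := by
  have h := (hq.hasLogVariation_sub' hx).latticeTheta_add_intVec (by fun_prop) (-z)
  simp only [map_neg, ← sub_eq_add_neg, sub_sub] at h
  rw [h.logVariation_eq]
  simp
  ring

theorem GeodesicDrawing.potential_sub [Fintype V] [DecidableEq V] [Fintype E] [DecidableEq E]
    {Γ : GeodesicDrawing G 1} {ω : E → ℝ} (hω : Γ.IsEquilibriumStress ω)
    (hD : IsNaturalDual D Ds)
    (hP : ∀ e, IsLift (P e) (D.path e)) (hQ : ∀ e, IsLift (Q e) (Ds.path e))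
    (hmeet : ∀ e, ∃ s t, P e s = Q e t) (hcross : ∀ e, HasCrossingNumber (P e) (Q e) 1) (e : E) :
    Γ.potential ω P (Q e 1) - Γ.potential ω P (Q e 0) = ω e • Γ.disp e := by
  choose x hx using fun v => proj_surjective 1 (D.pos v)
  -- The roles are exchanged: the angle is now taken along the dual edge, as seen from y. The linear
  -- term cancels the quasi-period, so that `A` descends to the vertices on the torus.
  let A : Plane → ℝ := fun y => (logVariation fun t => latticeTheta (Q e t - y)).im /
    (2 * Real.pi) + y 0 * (Q e 1 1 - Q e 0 1)
  have hA : ∀ v y, proj 1 y = D.pos v → A y = A (x v) := by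
    intro v y hy
    obtain ⟨z, rfl⟩ := proj_one_eq_proj_iff.mp ((hx v).trans hy.symm)
    have hxv : proj 1 (x v) ∉ Ds.image := by
      rw [hx]
      exact hD.pos_notMem v
    have h0 : (x v + intVec z) 0 = x v 0 + z 0 := rfl
    simp only [A]
    rw [(hQ e).variation_add_intVec hxv, h0]
    have := Real.pi_pos
    field_simp
    ring
  have hsum := hω.sum_coboundary fun v => A (x v)
  have hsingle : ∑ e₁, (if e₁ = e then (1 : ℝ) else 0) • ω e₁ • Γ.disp e₁ = ω e • Γ.disp e := by
    simp [ite_smul]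
  rw [← hsingle, ← sub_zero (∑ e₁, _ • ω e₁ • Γ.disp e₁), ← hsum, potential, potential,
    ← Finset.sum_sub_distrib, ← Finset.sum_sub_distrib]
  refine Finset.sum_congr rfl fun e₁ _ => ?_
  rw [← sub_smul, ← sub_smul]
  congr 1
  rw [← hA (G.tail e₁) (P e₁ 0) (by rw [hP, D.path_zero]),
    ← hA (G.head e₁) (P e₁ 1) (by rw [hP, D.path_one])]
  have hvar := congrArg Complex.im (hD.variation_eq hP hQ hmeet hcross e e₁)
  have hif : (if e₁ = e then ((2 * Real.pi : ℝ) : ℂ) * Complex.I else 0).im =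
      2 * Real.pi * if e₁ = e then (1 : ℝ) else 0 := by
    split_ifs <;> simp
  rw [hif] at hvar
  simp only [Complex.add_im, Complex.sub_im] at hvar
  simp only [A]
  have := Real.pi_pos
  field_simp
  linear_combination hvar

end Lifts

/-! ### The force diagram on the torus -/

section ForceDiagram

variable {Γ : GeodesicDrawing G 1} {ω : E → ℝ} {Ds : Drawing Gs SquareTorus}
  {h : F → Plane → Plane} {M : Matrix (Fin 2) (Fin 2) ℝ}

theorem IsPeriodic.proj_eq (hper : IsPeriodic M Ds h) {f : F} {x y : Plane}
    (hx : proj 1 x = Ds.pos f) (hy : proj 1 y = Ds.pos f) :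
    proj M (h f x) = proj M (h f y) := by
  obtain ⟨z, rfl⟩ := proj_one_eq_proj_iff.mp (hx.trans hy.symm)
  obtain ⟨w, hw⟩ := exists_intVec_eq_quarterTurn z
  rw [hper f x z hx, hw]
  exact proj_eq_proj_iff.mpr ⟨w, rfl⟩

/-- The straight-line homotopy from the normalized reciprocal diagram to the rotated dual. -/
theorem IsPeriodic.proj_homotopy_eq (hper : IsPeriodic M Ds h) (hM : M.det ≠ 0) {f : F}
    {x y : Plane} (hx : proj 1 x = Ds.pos f) (hy : proj 1 y = Ds.pos f) (s : ℝ) :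
    proj 1 ((1 - s) • M⁻¹.mulVec (h f x) + s • quarterTurn.mulVec x) =
      proj 1 ((1 - s) • M⁻¹.mulVec (h f y) + s • quarterTurn.mulVec y) := by
  obtain ⟨z, rfl⟩ := proj_one_eq_proj_iff.mp (hx.trans hy.symm)
  obtain ⟨w, hw⟩ := exists_intVec_eq_quarterTurn z
  refine proj_one_eq_proj_iff.mpr ⟨w, ?_⟩
  rw [hper f x z hx, Matrix.mulVec_add, Matrix.mulVec_add, Matrix.mulVec_mulVec,
    Matrix.nonsing_inv_mul M (isUnit_iff_ne_zero.mpr hM), Matrix.one_mulVec, hw]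
  module

theorem rotateSquare_proj (x : Plane) :
    rotateSquare (proj 1 x) = proj 1 (quarterTurn.mulVec x) := rfl

theorem exists_isParallelForceDiagram {Q : E → C(I, Plane)} (hQ : ∀ e, IsLift (Q e) (Ds.path e))
    (hrec : IsCoverReciprocal Γ ω Ds h) (hper : IsPeriodic M Ds h) (hM : M.det ≠ 0) :
    ∃ H : GeodesicDrawing Gs M, IsParallelForceDiagram Γ ω Ds h H := by
  choose x hx using fun f => proj_surjective 1 (Ds.pos f)
  have hQ0 : ∀ e, proj 1 (Q e 0) = Ds.pos (Gs.tail e) := fun e => by rw [hQ, Ds.path_zero]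
  have hQ1 : ∀ e, proj 1 (Q e 1) = Ds.pos (Gs.head e) := fun e => by rw [hQ, Ds.path_one]
  have hhead : ∀ e, h (Gs.head e) (Q e 1) = h (Gs.tail e) (Q e 0) + ω e • Γ.disp e := fun e =>
    sub_eq_iff_eq_add'.mp (hrec e (Q e) (hQ e))
  have hcancel : ∀ v, M.mulVec (M⁻¹.mulVec v) = v := fun v => by
    rw [Matrix.mulVec_mulVec, Matrix.mul_nonsing_inv M (isUnit_iff_ne_zero.mpr hM),
      Matrix.one_mulVec]
  have hzero : ∀ u v : Plane, (1 - ((0 : I) : ℝ)) • u + ((0 : I) : ℝ) • v = u := by simp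
  let H : GeodesicDrawing Gs M :=
    { pos := fun f => proj M (h f (x f))
      disp := fun e => ω e • Γ.disp e
      pos_head := fun e => by
        rw [← hper.proj_eq (hQ1 e) (hx _), ← hper.proj_eq (hQ0 e) (hx _), hhead, proj_add] }
  -- Vertices use the lifts `x f` and paths the endpoints of `Q e`; `proj_homotopy_eq` makes them
  -- agree on the torus. `Φ 0` is the diagram normalized by M⁻¹, and `Φ 1` is the rotated dual.
  let Φ : I → Drawing Gs SquareTorus := fun s =>
    { pos := fun f => proj 1 ((1 - (s : ℝ)) • M⁻¹.mulVec (h f (x f)) +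
        (s : ℝ) • quarterTurn.mulVec (x f))
      path := fun e =>
        ⟨fun t => proj 1 ((1 - (s : ℝ)) • M⁻¹.mulVec (h (Gs.tail e) (Q e 0) +
          (t : ℝ) • ω e • Γ.disp e) + (s : ℝ) • quarterTurn.mulVec (Q e t)), by fun_prop⟩
      path_zero := fun e => by
        have := hper.proj_homotopy_eq hM (hQ0 e) (hx _) s
        simpa using this
      path_one := fun e => by
        have := hper.proj_homotopy_eq hM (hQ1 e) (hx _) s
        rw [hhead] at this
        simpa using this }
  refine ⟨H, fun e => rfl, ⟨Φ 0, ?_, Φ, ?_, ?_, rfl, ?_⟩, hrec, hper,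
    fun f y hy => hper.proj_eq (hx f) hy⟩
  · ext e t
    · change proj M (M.mulVec ((1 - ((0 : I) : ℝ)) • M⁻¹.mulVec (h e (x e)) +
        ((0 : I) : ℝ) • quarterTurn.mulVec (x e))) = proj M (h e (x e))
      rw [hzero, hcancel]
    · change proj M (M.mulVec ((1 - ((0 : I) : ℝ)) • M⁻¹.mulVec (h (Gs.tail e) (Q e 0) +
        (t : ℝ) • ω e • Γ.disp e) + ((0 : I) : ℝ) • quarterTurn.mulVec (Q e t))) =
          proj M (h (Gs.tail e) (x (Gs.tail e))) + proj M ((t : ℝ) • ω e • Γ.disp e)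
      rw [hzero, hcancel, proj_add, hper.proj_eq (hx _) (hQ0 e)]
  · intro f
    simp only [Φ]
    fun_prop
  · intro e
    simp only [Φ, ContinuousMap.coe_mk]
    fun_prop
  · ext
    · simp [Drawing.map, Φ, ← hx, rotateSquare_proj]
    · simp [Drawing.map, Φ, ← hQ _ _, rotateSquare_proj]

end ForceDiagram

end

end TorusGraph

/-! ### The potential as reciprocal diagram. -/

theorem lemmaL {V E F : Type*} [Fintype V] [DecidableEq V] [Fintype E] [DecidableEq E]
    (G : TorusGraph.Graph V E) (Gs : TorusGraph.Graph F E)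
    (Γ : TorusGraph.GeodesicDrawing G 1)
    (D : TorusGraph.Drawing G TorusGraph.SquareTorus)
    (Ds : TorusGraph.Drawing Gs TorusGraph.SquareTorus)
    (hΓ : Γ.toDrawing.Homotopic D)
    (hD : TorusGraph.IsNaturalDual D Ds)
    (ω : E → ℝ) (hω : Γ.IsEquilibriumStress ω) :
    ∃ h : F → TorusGraph.Plane → TorusGraph.Plane,
      TorusGraph.IsCoverReciprocal Γ ω Ds h ∧
      TorusGraph.IsPeriodic (Γ.covariance ω) Ds h ∧
      ((Γ.covariance ω).det ≠ 0 →
        ∃ H : TorusGraph.GeodesicDrawing Gs (Γ.covariance ω),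
          TorusGraph.IsParallelForceDiagram Γ ω Ds h H) := by
  choose P Q hP hQ hmeet hcross using hD.crosses_right_to_left
  -- The same potential serves every dual vertex. Dual vertices avoid the embedded graph, so the
  -- logarithmic variations in it exist and are not the default 0.
  have hper : TorusGraph.IsPeriodic (Γ.covariance ω) Ds fun _ => Γ.potential ω P := by
    intro f x z hx
    refine TorusGraph.GeodesicDrawing.potential_add_intVec hω hΓ hP ?_ z
    rw [hx]
    exact hD.dual_pos_notMem f
  have hrec : TorusGraph.IsCoverReciprocal Γ ω Ds fun _ => Γ.potential ω P := by
    intro e q hq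
    -- Any other lift is a translate of `Q e`, and the period added at its two ends cancels.
    obtain ⟨z, hz⟩ := (hQ e).exists_eq_add hq
    have h := TorusGraph.GeodesicDrawing.potential_sub hω hD hP hQ hmeet hcross e
    rw [hz, hz, hper (Gs.head e) (Q e 1) z (by rw [hQ, Ds.path_one]),
      hper (Gs.tail e) (Q e 0) z (by rw [hQ, Ds.path_zero]), ← h]
    abel
  exact ⟨fun _ => Γ.potential ω P, hrec, hper,
    TorusGraph.exists_isParallelForceDiagram hQ hrec hper⟩
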